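/- Let $k_0\subseteq k\subseteq\mathbb{C}$ be number fields such that $k/k_0$ is a quadratic extension whose nontrivial automorphism is complex conjugation. Let $L/k$ be a finite Galois extension with $L\subseteq\mathbb{C}$ and Galois group $G$, and assume that complex conjugation induces an automorphism $\alpha$ of $L$. Let $\xi$ be a $2$-cocycle of $G$ with values in $L^\times$ such that $\alpha(\xi_{\sigma,\rho})\,\xi_{\sigma,\rho}=1$ for all $\sigma,\rho\in G$, and let $B=(\xi,L/k,G)$ be the crossed product algebra: $B=\bigoplus_{\sigma\in G}L e_\sigma$ with $e_\sigma\lambda=\sigma(\lambda)e_\sigma$ for $\lambda\in L$, and $e_\sigma e_\rho=\xi_{\sigma,\rho}e_{\sigma\rho}$. Assume that $B$ is a division algebra. A unitary involution on $B$ (with respect to $k/k_0$) is an additive map $\tau:B\to B$ with $\tau(xy)=\tau(y)\tau(x)$ and $\tau(\tau(x))=x$ for all $x,y\in B$, whose fixed field in the centre $k$ of $B$ is $k_0$. It is positive (definite) if $\operatorname{Trd}_B(\tau(x)x)>0$ for all nonzero $x\in B$, with respect to the ordering that $k_0\subseteq\mathbb{R}$ inherits from $\mathbb{R}$, where $\operatorname{Trd}_B:B\to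 k$ denotes the reduced trace. Then $B$ carries a positive unitary involution $\tau$ with $\tau|_L=\alpha$ if and only if $\alpha\circ\sigma=\sigma\circ\alpha$ for all $\sigma\in G$. -/

import Mathlib

open scoped TensorProduct

universe u v w

noncomputable section

namespace CrossedProd

section Construction

variable (k : Type u) (L : Type v) [Field k] [Field L] [Algebra k L]

/-- `ξ` is a (multiplicative) `2`-cocycle of `Gal(L/k)` with values in `Lˣ`, for the natural action:
`ξ(gh, j) ξ(g, h) = g(ξ(h, j)) ξ(g, hj)` for all `g, h, j`. -/
def IsTwoCocycle (ξ : Gal(L/k) × Gal(L/k) → Lˣ) : Prop :=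
  groupCohomology.IsMulCocycle₂ ξ

/-- The crossed product algebra `(ξ, L/k, G)`, with `G = Gal(L/k)`, as a set: the element
`∑ σ, x_σ e_σ` of the left `L`-vector space with basis `(e_σ)` indexed by `G` is given by
its coefficients `x_σ`. Here `ξ` is a `2`-cocycle of `G` with values in `Lˣ`, not
assumed to be normalized. -/
structure CrossedProduct (ξ : Gal(L/k) × Gal(L/k) → Lˣ) (hξ : IsTwoCocycle k L ξ) : Type v where
  coeff : Gal(L/k) → L

variable {k L} {ξ : Gal(L/k) × Gal(L/k) → Lˣ} {hξ : IsTwoCocycle k L ξ}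

namespace CrossedProduct

/-- An element is the same as its family of coefficients. -/
def coeffEquiv : CrossedProduct k L ξ hξ ≃ (Gal(L/k) → L) where
  toFun := coeff
  invFun := mk
  left_inv _ := rfl
  right_inv _ := rfl

/-- Coefficientwise addition. -/
instance : AddCommGroup (CrossedProduct k L ξ hξ) := coeffEquiv.addCommGroup

/-- The left `L`-vector space structure `a (∑ σ, x_σ e_σ) = ∑ σ, (a x_σ) e_σ`. -/
instance : Module L (CrossedProduct k L ξ hξ) := coeffEquiv.module L

instance : Module k (CrossedProduct k L ξ hξ) := coeffEquiv.module k

open Classical in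
/-- The identity element is `ξ(1,1)⁻¹ e_1`. -/
instance : One (CrossedProduct k L ξ hξ) where
  one := ⟨fun g => if g = 1 then (((ξ (1, 1))⁻¹ : Lˣ) : L) else 0⟩

@[ext] theorem ext {x y : CrossedProduct k L ξ hξ} (h : ∀ g, x.coeff g = y.coeff g) : x = y :=
  coeffEquiv.injective (funext h)

theorem add_apply (x y : CrossedProduct k L ξ hξ) (g : Gal(L/k)) :
    (x + y).coeff g = x.coeff g + y.coeff g := rfl

theorem zero_apply (g : Gal(L/k)) : (0 : CrossedProduct k L ξ hξ).coeff g = 0 := rfl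

theorem smul_apply (a : L) (x : CrossedProduct k L ξ hξ) (g : Gal(L/k)) :
    (a • x).coeff g = a * x.coeff g := rfl

theorem ksmul_apply (a : k) (x : CrossedProduct k L ξ hξ) (g : Gal(L/k)) :
    (a • x).coeff g = a • x.coeff g := rfl

open Classical in
theorem one_apply (g : Gal(L/k)) : (1 : CrossedProduct k L ξ hξ).coeff g =
    if g = 1 then (((ξ (1, 1))⁻¹ : Lˣ) : L) else 0 := rfl

theorem cocycle_coe (hξ : IsTwoCocycle k L ξ) (g h j : Gal(L/k)) :
    (ξ (g * h, j) : L) * ξ (g, h) = g (ξ (h, j) : L) * ξ (g, h * j) := by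
  have := congrArg (Units.val) (hξ g h j)
  simpa using this

section Mul

variable [FiniteDimensional k L]

/-- The multiplication, that is, the biadditive extension of
`(a e_σ) (b e_ρ) = a σ(b) ξ(σ, ρ) e_{σρ}`. -/
instance : Mul (CrossedProduct k L ξ hξ) where
  mul x y := ⟨fun g => ∑ h : Gal(L/k), x.coeff h * h (y.coeff (h⁻¹ * g)) * (ξ (h, h⁻¹ * g) : L)⟩

theorem mul_apply (x y : CrossedProduct k L ξ hξ) (g : Gal(L/k)) :
    (x * y).coeff g =
      ∑ h : Gal(L/k), x.coeff h * h (y.coeff (h⁻¹ * g)) * (ξ (h, h⁻¹ * g) : L) := rfl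

theorem mul_assoc' (x y z : CrossedProduct k L ξ hξ) : x * y * z = x * (y * z) := by
  ext g
  simp only [mul_apply, map_sum, map_mul, Finset.sum_mul, Finset.mul_sum]
  rw [Finset.sum_comm]
  refine Finset.sum_congr rfl fun j _ => ?_
  refine Fintype.sum_equiv (Equiv.mulLeft j⁻¹) _ _ fun h => ?_
  have hc := cocycle_coe hξ j (j⁻¹ * h) (h⁻¹ * g)
  have e1 : j * (j⁻¹ * h) = h := by group
  have e2 : (j⁻¹ * h) * (h⁻¹ * g) = j⁻¹ * g := by group
  have e3 : (j⁻¹ * h)⁻¹ * (j⁻¹ * g) = h⁻¹ * g := by group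
  have e4 : ∀ t : L, j ((j⁻¹ * h) t) = h t := fun t => by
    rw [← AlgEquiv.mul_apply, e1]
  rw [e1, e2] at hc
  simp only [Equiv.coe_mulLeft, e3, e4]
  linear_combination (x.coeff j * j (y.coeff (j⁻¹ * h)) * h (z.coeff (h⁻¹ * g))) * hc

theorem one_mul' (x : CrossedProduct k L ξ hξ) : 1 * x = x := by
  ext g
  rw [mul_apply, Finset.sum_eq_single (1 : Gal(L/k))]
  · rw [one_apply, if_pos rfl, inv_one, one_mul, groupCohomology.map_one_fst_of_isMulCocycle₂ hξ g,
      AlgEquiv.one_apply]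
    rw [mul_right_comm, Units.inv_mul, one_mul]
  · intro h _ hh
    rw [one_apply, if_neg hh, zero_mul, zero_mul]
  · simp

theorem mul_one' (x : CrossedProduct k L ξ hξ) : x * 1 = x := by
  ext g
  rw [mul_apply, Finset.sum_eq_single g]
  · have h1 : (ξ (g, 1) : L) = g (ξ (1, 1) : L) := by
      rw [groupCohomology.map_one_snd_of_isMulCocycle₂ hξ]; simp
    rw [one_apply, inv_mul_cancel, if_pos rfl, h1, mul_assoc, ← map_mul, Units.inv_mul, map_one,
      mul_one]
  · intro h _ hh
    have : h⁻¹ * g ≠ 1 := fun H => hh (inv_mul_eq_one.mp H)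
    rw [one_apply, if_neg this, map_zero, mul_zero, zero_mul]
  · simp

instance : Ring (CrossedProduct k L ξ hξ) where
  __ := (inferInstance : AddCommGroup (CrossedProduct k L ξ hξ))
  mul_assoc := mul_assoc'
  one_mul := one_mul'
  mul_one := mul_one'
  zero_mul x := by ext g; simp [mul_apply, zero_apply]
  mul_zero x := by ext g; simp [mul_apply, zero_apply]
  left_distrib x y z := by
    ext g; simp [mul_apply, add_apply, mul_add, add_mul, Finset.sum_add_distrib]
  right_distrib x y z := by
    ext g; simp [mul_apply, add_apply, add_mul, Finset.sum_add_distrib]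

theorem smul_mul' (a : L) (x y : CrossedProduct k L ξ hξ) : a • x * y = a • (x * y) := by
  ext g
  simp only [mul_apply, smul_apply, Finset.mul_sum, mul_assoc]

instance : Algebra k (CrossedProduct k L ξ hξ) :=
  Algebra.ofModule
    (fun r x y => by
      ext g
      simp only [mul_apply, ksmul_apply, Finset.smul_sum, smul_mul_assoc])
    (fun r x y => by
      ext g
      simp only [mul_apply, ksmul_apply, Finset.smul_sum, smul_mul_assoc, mul_smul_comm,
        map_smul])

/-- The embedding of `L` as a subfield of the crossed product, `a ↦ a · 1`. -/
def ofField : L →ₐ[k] CrossedProduct k L ξ hξ where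
  toFun a := a • 1
  map_one' := one_smul _ _
  map_mul' a b := by rw [smul_mul', one_mul, mul_smul]
  map_zero' := zero_smul _ _
  map_add' a b := add_smul _ _ _
  commutes' r := by
    ext g
    simp only [Algebra.algebraMap_eq_smul_one, smul_apply, ksmul_apply, Algebra.smul_mul_assoc,
      one_mul]

end Mul

end CrossedProduct

end Construction

/-- `t` is the trace of the matrix of `b ⊗ 1` under some isomorphism `K ⊗_k B ≅ M_n(K)`,
for some splitting field `K` of the `k`-algebra `B`. -/
def IsReducedTrace (k : Type u) (B : Type v) [Field k] [Ring B] [Algebra k B] (b : B) (t : k) :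
    Prop :=
  ∃ (K : Type u) (_ : Field K) (_ : Algebra k K) (n : ℕ)
    (e : K ⊗[k] B ≃ₐ[K] Matrix (Fin n) (Fin n) K),
    algebraMap k K t = (e ((1 : K) ⊗ₜ[k] b)).trace

open Classical in
/-- The reduced trace `Trd_B : B → k` of a central simple `k`-algebra `B`. (For such `B`, there is
exactly one `t` with `IsReducedTrace k B b t`, independently of the splitting field and of
the isomorphism. For an algebra that is not central simple the value carries no meaning.) -/
def reducedTrace (k : Type u) (B : Type v) [Field k] [Ring B] [Algebra k B] (b : B) : k :=
  if h : ∃ t : k, IsReducedTrace k B b t then h.choose else 0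

/-- `τ` is a unitary `k/k₀`-involution on the central `k`-algebra `B`: an additive,
antimultiplicative map of order at most two, whose fixed field inside the centre `k` is `k₀`.
(It is meant for `k/k₀` quadratic; then `τ` restricts to the nontrivial automorphism
of `k/k₀`.) -/
structure IsUnitaryInvolution (k₀ : Type w) (k : Type u) {B : Type v} [Field k₀] [Field k]
    [Algebra k₀ k] [Ring B] [Algebra k B] (τ : B → B) : Prop where
  map_add : ∀ x y, τ (x + y) = τ x + τ y
  map_mul : ∀ x y, τ (x * y) = τ y * τ x
  involutive : ∀ x, τ (τ x) = x
  fixed_iff : ∀ c : k, τ (algebraMap k B c) = algebraMap k B c ↔ c ∈ Set.range (algebraMap k₀ k)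

/-- Positivity of an involution `τ` on a central simple algebra `B` over a field `k` of complex
numbers: the involution trace form `x ↦ Trd_B (τ(x) x)` is positive definite, i.e.
`Trd_B (τ(x) x)` is a positive real number for all `x ≠ 0`. -/
def IsPositiveInvolution (k : Type u) {B : Type v} [Field k] [Algebra k ℂ] [Ring B] [Algebra k B]
    (τ : B → B) : Prop :=
  ∀ x : B, x ≠ 0 →
    (algebraMap k ℂ (reducedTrace k B (τ x * x))).im = 0 ∧
      0 < (algebraMap k ℂ (reducedTrace k B (τ x * x))).re

end CrossedProd

end

/-! The reduced trace of `x` is the trace from `L` to `k` of its component in `L`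
(`reducedTrace_eq`), so positivity becomes a question about sums of Galois conjugates.

If `α` commutes with `G`, the map `∑ x_σ e_σ ↦ ∑ e_σ⁻¹ α(x_σ)` is an involution because `ξ` is
unitary (`conjugation_mul`, `conjugation_involutive`). The reduced trace of `τ(x) x` is then a sum
of squared absolute values of conjugates of the `x_σ`.

Conversely, positivity on `L` says that the trace of `α(z) z` is positive for `z ≠ 0`. This trace is
the value at the vector of conjugates `(σ z)_σ` of a form on `ℂ^G` built from the permutation `σ ↦
ασα`, and the form takes negative values unless that permutation is trivial. Since `k` is dense in
`ℂ`, independence of characters makes the vectors of conjugates dense in `ℂ^G`, so a negative value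
would be attained on `L` (`commute_of_trace_pos`). -/

/-- A linear form vanishing on all these vectors is a linear relation between distinct characters of
`L`, hence zero by Dedekind. -/
theorem span_range_galois_eq_top (k : Type*) (L : Type*) (F : Type*) [Field k] [Field L]
    [Field F] [Algebra k L] [Algebra L F] [FiniteDimensional k L] :
    Submodule.span F (Set.range fun (z : L) (σ : Gal(L/k)) => algebraMap L F (σ z)) = ⊤ := by
  classical
  by_contra hne
  obtain ⟨f, hf0, hf⟩ := Submodule.exists_le_ker_of_lt_top _ (lt_top_iff_ne_top.mpr hne)
  let χ : Gal(L/k) → (L →* F) := fun σ =>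
    ((algebraMap L F).comp (σ : L →+* L) : L →+* F).toMonoidHom
  have hχ : Function.Injective χ := by
    intro σ ρ h
    ext z
    exact (algebraMap L F).injective (DFunLike.congr_fun h z)
  have hli := (linearIndependent_monoidHom L F).comp χ hχ
  rw [Fintype.linearIndependent_iff] at hli
  have hf' : ∀ v : Gal(L/k) → F, f v = ∑ σ, f (Pi.single σ 1) * v σ := by
    intro v
    conv_lhs => rw [pi_eq_sum_univ' v]
    simp only [map_sum, map_smul, smul_eq_mul, mul_comm]
  have h0 := hli (fun σ => f (Pi.single σ 1)) (by
    ext z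
    have hz : f (fun σ : Gal(L/k) => algebraMap L F (σ z)) = 0 :=
      hf (Submodule.subset_span ⟨z, rfl⟩)
    rw [hf'] at hz
    simpa [χ] using hz)
  exact hf0 (LinearMap.ext fun v => by rw [hf']; simp [h0])

namespace CrossedProd.CrossedProduct

/-! ### Calculus of the monomials `a e_σ` -/

section Monomial

variable {k : Type u} {L : Type v} [Field k] [Field L] [Algebra k L]
  {ξ : Gal(L/k) × Gal(L/k) → Lˣ} {hξ : IsTwoCocycle k L ξ}

open Classical in
/-- The element `a e_σ` of the crossed product. -/
noncomputable def monomial (hξ : IsTwoCocycle k L ξ) (σ : Gal(L/k)) (a : L) : CrossedProduct k L ξ hξ :=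
  ⟨Pi.single σ a⟩

open Classical in
theorem monomial_apply (σ g : Gal(L/k)) (a : L) :
    (monomial hξ σ a).coeff g = if g = σ then a else 0 := by
  simp [monomial, Pi.single_apply]

theorem cocycle_one_left (hξ : IsTwoCocycle k L ξ) (g : Gal(L/k)) : ξ (1, g) = ξ (1, 1) :=
  groupCohomology.map_one_fst_of_isMulCocycle₂ hξ g

theorem cocycle_one_right (hξ : IsTwoCocycle k L ξ) (g : Gal(L/k)) :
    (ξ (g, 1) : L) = g (ξ (1, 1) : L) := by
  rw [groupCohomology.map_one_snd_of_isMulCocycle₂ hξ]; simp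

theorem one_eq_monomial : (1 : CrossedProduct k L ξ hξ) = monomial hξ 1 ((ξ (1, 1) : L)⁻¹) := by
  ext g
  rw [one_apply, monomial_apply, Units.val_inv_eq_inv_val]

/-- The coefficient functions as a linear equivalence. -/
noncomputable def coeffLinearEquiv (hξ : IsTwoCocycle k L ξ) :
    CrossedProduct k L ξ hξ ≃ₗ[k] (Gal(L/k) → L) :=
  { coeffEquiv with
    map_add' := fun _ _ => rfl
    map_smul' := fun _ _ => rfl }

variable [FiniteDimensional k L]

instance : FiniteDimensional k (CrossedProduct k L ξ hξ) :=
  Module.Finite.equiv (coeffLinearEquiv hξ).symm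

theorem sum_apply {ι : Type*} (s : Finset ι) (x : ι → CrossedProduct k L ξ hξ) (g : Gal(L/k)) :
    (∑ i ∈ s, x i).coeff g = ∑ i ∈ s, (x i).coeff g := by
  have h : ∀ y, coeffLinearEquiv hξ y g = y.coeff g := fun _ => rfl
  simp_rw [← h, map_sum, Finset.sum_apply]

theorem eq_sum_monomial (x : CrossedProduct k L ξ hξ) :
    x = ∑ σ, monomial hξ σ (x.coeff σ) := by
  ext g
  rw [sum_apply, Finset.sum_eq_single g] <;> simp +contextual [monomial_apply, eq_comm]

theorem monomial_mul_monomial (σ ρ : Gal(L/k)) (a b : L) :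
    monomial hξ σ a * monomial hξ ρ b = monomial hξ (σ * ρ) (a * σ b * ξ (σ, ρ)) := by
  ext g
  rw [mul_apply, Finset.sum_eq_single σ]
  · simp only [monomial_apply, if_true]
    by_cases h : g = σ * ρ
    · subst h; simp
    · have h' : σ⁻¹ * g ≠ ρ := fun H => h (by rw [← H]; group)
      simp [h, h']
  · intro h _ hh
    simp [monomial_apply, hh]
  · simp

theorem ofField_eq_monomial (a : L) :
    (ofField a : CrossedProduct k L ξ hξ) = monomial hξ 1 (a * (ξ (1, 1) : L)⁻¹) := by
  ext g
  change (a • (1 : CrossedProduct k L ξ hξ)).coeff g = _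
  rw [smul_apply, one_eq_monomial, monomial_apply, monomial_apply]
  split_ifs <;> simp

theorem ofField_mul_monomial (σ : Gal(L/k)) (a b : L) :
    ofField a * monomial hξ σ b = monomial hξ σ (a * b) := by
  rw [ofField_eq_monomial, monomial_mul_monomial, one_mul, cocycle_one_left hξ σ]
  congr 1
  have := (ξ (1, 1)).ne_zero
  rw [AlgEquiv.one_apply]; field_simp

theorem monomial_mul_ofField (σ : Gal(L/k)) (a b : L) :
    monomial hξ σ b * ofField a = monomial hξ σ (b * σ a) := by
  rw [ofField_eq_monomial, monomial_mul_monomial, mul_one]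
  congr 1
  have : σ (ξ (1, 1) : L) ≠ 0 := by simp
  rw [map_mul, map_inv₀, cocycle_one_right hξ σ]; field_simp

theorem monomial_one (a : L) : monomial hξ 1 a = ofField (a * ξ (1, 1)) := by
  rw [ofField_eq_monomial]; simp

theorem finrank_eq [IsGalois k L] :
    Module.finrank k (CrossedProduct k L ξ hξ) = Module.finrank k L ^ 2 := by
  rw [(coeffLinearEquiv hξ).finrank_eq, Module.finrank_pi_fintype]
  simp [← Nat.card_eq_fintype_card, IsGalois.card_aut_eq_finrank, sq]

variable (ξ) in
/-- The elements `c_σ` of `L` such that the inverse of `e_σ` is `c_{σ⁻¹}⁻¹ e_{σ⁻¹}`. -/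
def invCoeff (σ : Gal(L/k)) : L := ξ (σ, σ⁻¹) * ξ (1, 1)

omit [FiniteDimensional k L] in
theorem invCoeff_ne_zero (σ : Gal(L/k)) : invCoeff ξ σ ≠ 0 := by simp [invCoeff]

omit [FiniteDimensional k L] in
theorem apply_invCoeff_inv (hξ : IsTwoCocycle k L ξ) (σ : Gal(L/k)) :
    σ (invCoeff ξ σ⁻¹) = invCoeff ξ σ := by
  have hc := cocycle_coe hξ σ σ⁻¹ σ
  rw [inv_mul_cancel, mul_inv_cancel, cocycle_one_left hξ σ, cocycle_one_right hξ σ] at hc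
  rw [invCoeff, invCoeff, map_mul, inv_inv, ← hc, mul_comm]

theorem monomial_inv_mul (σ : Gal(L/k)) :
    monomial hξ σ⁻¹ (invCoeff ξ σ⁻¹)⁻¹ * monomial hξ σ 1 = 1 := by
  rw [monomial_mul_monomial, one_eq_monomial, inv_mul_cancel, invCoeff, inv_inv, map_one]
  congr 1
  have := (ξ (1, 1)).ne_zero
  have := (ξ (σ⁻¹, σ)).ne_zero
  field_simp

theorem monomial_mul_inv (σ : Gal(L/k)) :
    monomial hξ σ 1 * monomial hξ σ⁻¹ (invCoeff ξ σ⁻¹)⁻¹ = 1 := by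
  rw [monomial_mul_monomial, one_eq_monomial, mul_inv_cancel, map_inv₀, apply_invCoeff_inv hξ,
    invCoeff]
  congr 1
  have := (ξ (1, 1)).ne_zero
  have := (ξ (σ, σ⁻¹)).ne_zero
  field_simp

/-! ### Linear functionals that vanish on commutators -/

section TraceFunctional

variable {M : Type*} [AddCommGroup M] [Module k M]
  (f : CrossedProduct k L ξ hξ →ₗ[k] M) (hf : ∀ x y, f (x * y) = f (y * x))
include hf

/-- If `σ` moves `z`, the commutator of `z` with `b e_σ` is `(z - σ z) b e_σ`; taking `b = a / (z -
σ z)` exhibits `a e_σ` as a commutator. -/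
theorem traceFunctional_monomial_eq_zero {σ : Gal(L/k)} (hσ : σ ≠ 1) (a : L) :
    f (monomial hξ σ a) = 0 := by
  obtain ⟨z, hz⟩ : ∃ z, σ z ≠ z := by
    by_contra! h
    exact hσ (AlgEquiv.ext h)
  have h := hf (ofField z) (monomial hξ σ (a * (z - σ z)⁻¹))
  rw [ofField_mul_monomial, monomial_mul_ofField, ← sub_eq_zero, ← map_sub] at h
  rw [← h]
  congr 1
  have : z - σ z ≠ 0 := sub_ne_zero.mpr (Ne.symm hz)
  ext g
  have e : ∀ x y : CrossedProduct k L ξ hξ, (x - y).coeff g = x.coeff g - y.coeff g :=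
    fun _ _ => rfl
  rw [e, monomial_apply, monomial_apply, monomial_apply]
  split_ifs
  · field_simp
  · simp

/-- `σ(a)` is the conjugate of `a` by the unit `e_σ`. -/
theorem traceFunctional_ofField_galois (σ : Gal(L/k)) (a : L) :
    f (ofField (σ a)) = f (ofField a) := by
  have h := hf (monomial hξ σ 1 * ofField a) (monomial hξ σ⁻¹ (invCoeff ξ σ⁻¹)⁻¹)
  have h1 : monomial hξ σ 1 * ofField a = ofField (σ a) * monomial hξ σ 1 := by
    rw [monomial_mul_ofField, ofField_mul_monomial, mul_comm]
  rw [← mul_assoc, monomial_inv_mul, one_mul, h1, mul_assoc, monomial_mul_inv, mul_one] at h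
  exact h

/-- Only the component in `L` contributes, and averaging it over `G` replaces it by its trace, a
scalar. Thus `f` is determined by `f 1` once the degree is invertible. -/
theorem traceFunctional_eq [IsGalois k L] (x : CrossedProduct k L ξ hξ) :
    (Module.finrank k L : k) • f x = Algebra.trace k L (x.coeff 1 * ξ (1, 1)) • f 1 := by
  have hx : f x = f (ofField (x.coeff 1 * ξ (1, 1))) := by
    conv_lhs => rw [eq_sum_monomial x]
    rw [map_sum, Finset.sum_eq_single 1, monomial_one]
    · intro σ _ hσ
      exact traceFunctional_monomial_eq_zero f hf hσ _
    · simp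
  rw [hx]
  generalize x.coeff 1 * (ξ (1, 1) : L) = a
  have h : f (ofField (algebraMap k L (Algebra.trace k L a))) =
      (Module.finrank k L : k) • f (ofField a) := by
    rw [trace_eq_sum_automorphisms, map_sum, map_sum]
    simp_rw [traceFunctional_ofField_galois f hf]
    rw [Finset.sum_const, Finset.card_univ, ← Nat.card_eq_fintype_card,
      IsGalois.card_aut_eq_finrank, Nat.cast_smul_eq_nsmul]
  rw [← h, AlgHom.commutes, Algebra.algebraMap_eq_smul_one, map_smul]

end TraceFunctional

end Monomial

end CrossedProd.CrossedProduct
namespace CrossedProd.CrossedProduct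

/-! ### Splitting of the crossed product over `L` -/

section Splitting

variable {k : Type u} {L : Type v} [Field k] [Field L] [Algebra k L] [FiniteDimensional k L]
  {ξ : Gal(L/k) × Gal(L/k) → Lˣ} {hξ : IsTwoCocycle k L ξ}

theorem leftMulMatrix_mul_aux (x y : CrossedProduct k L ξ hξ) (h g : Gal(L/k)) :
    h⁻¹ ((x * y).coeff (h * g⁻¹) * (ξ (h * g⁻¹, g) : L)) =
      ∑ j : Gal(L/k), h⁻¹ (x.coeff (h * j⁻¹) * (ξ (h * j⁻¹, j) : L)) *
        j⁻¹ (y.coeff (j * g⁻¹) * (ξ (j * g⁻¹, g) : L)) := by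
  rw [mul_apply, Finset.sum_mul, map_sum]
  refine (Fintype.sum_equiv ((Equiv.inv _).trans (Equiv.mulLeft h)) _ _ fun j => ?_).symm
  have e1 : ∀ t : L, j⁻¹ t = h⁻¹ ((h * j⁻¹) t) := fun t => by
    rw [← AlgEquiv.mul_apply, inv_mul_cancel_left]
  simp only [Equiv.trans_apply, Equiv.inv_apply, Equiv.coe_mulLeft]
  rw [e1, ← map_mul]
  congr 1
  have hc := cocycle_coe hξ (h * j⁻¹) (j * g⁻¹) g
  have e2 : h * j⁻¹ * (j * g⁻¹) = h * g⁻¹ := by group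
  have e3 : (h * j⁻¹)⁻¹ * (h * g⁻¹) = j * g⁻¹ := by group
  rw [e2, inv_mul_cancel_right] at hc
  rw [e3, map_mul]
  linear_combination -(x.coeff (h * j⁻¹) * (h * j⁻¹) (y.coeff (j * g⁻¹))) * hc

open Classical in
/-- The action of the crossed product on itself by left multiplication, as matrices over `L` with
respect to the basis `(e_σ)` of the right `L`-vector space underlying the crossed product. -/
noncomputable def leftMulMatrix (hξ : IsTwoCocycle k L ξ) :
    CrossedProduct k L ξ hξ →ₐ[k] Matrix Gal(L/k) Gal(L/k) L :=
  AlgHom.ofLinearMap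
    { toFun := fun x => Matrix.of fun h g => h⁻¹ (x.coeff (h * g⁻¹) * (ξ (h * g⁻¹, g) : L))
      map_add' := fun x y => by ext h g; simp [add_apply, add_mul]
      map_smul' := fun c x => by ext h g; simp [ksmul_apply] }
    (by
      ext h g
      simp only [LinearMap.coe_mk, AddHom.coe_mk, Matrix.of_apply, one_apply, Matrix.one_apply]
      by_cases hg : h = g
      · subst hg
        rw [mul_inv_cancel, cocycle_one_left hξ h]
        simp
      · have : h * g⁻¹ ≠ 1 := fun H => hg (mul_inv_eq_one.mp H)
        simp [hg, this])
    (fun x y => by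
      ext h g
      exact leftMulMatrix_mul_aux x y h g)

theorem leftMulMatrix_apply (x : CrossedProduct k L ξ hξ) (h g : Gal(L/k)) :
    leftMulMatrix hξ x h g = h⁻¹ (x.coeff (h * g⁻¹) * (ξ (h * g⁻¹, g) : L)) := rfl

open Classical in
/-- The `L`-linear extension of `leftMulMatrix`. -/
noncomputable def splittingHom (hξ : IsTwoCocycle k L ξ) :
    L ⊗[k] CrossedProduct k L ξ hξ →ₐ[L] Matrix Gal(L/k) Gal(L/k) L :=
  Algebra.TensorProduct.lift (Algebra.ofId L _) (leftMulMatrix hξ)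
    fun _ _ => Algebra.commutes _ _

open Classical in
theorem splittingHom_one_tmul (x : CrossedProduct k L ξ hξ) :
    splittingHom hξ (1 ⊗ₜ x) = leftMulMatrix hξ x := by
  refine (Algebra.TensorProduct.lift_tmul _ _ _ _ _).trans ?_
  rw [map_one, one_mul]

open Classical in
theorem splittingHom_surjective (hξ : IsTwoCocycle k L ξ) :
    Function.Surjective (splittingHom hξ) := by
  let R : Submodule L (Matrix Gal(L/k) Gal(L/k) L) := LinearMap.range (splittingHom hξ).toLinearMap
  have hR : ∀ x, leftMulMatrix hξ x ∈ R := fun x => ⟨1 ⊗ₜ x, splittingHom_one_tmul x⟩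
  -- The range of `D σ` consists of all matrices supported on `h * g⁻¹ = σ`. The matrix of `z e_σ`
  -- is `D σ` of the vector of conjugates of `z`, and such vectors span.
  let D : Gal(L/k) → (Gal(L/k) → L) →ₗ[L] Matrix Gal(L/k) Gal(L/k) L := fun σ =>
    { toFun := fun v => Matrix.of fun h g =>
        if h * g⁻¹ = σ then v h⁻¹ * h⁻¹ (ξ (h * g⁻¹, g) : L) else 0
      map_add' := fun v w => by ext h g; by_cases H : h * g⁻¹ = σ <;> simp [H, add_mul]
      map_smul' := fun c v => by ext h g; by_cases H : h * g⁻¹ = σ <;> simp [H, mul_assoc] }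
  have hD : ∀ σ, LinearMap.range (D σ) ≤ R := by
    intro σ
    rw [LinearMap.range_eq_map, ← span_range_galois_eq_top k L L, Submodule.map_span_le]
    rintro _ ⟨z, rfl⟩
    convert hR (monomial hξ σ z)
    ext h g
    rw [leftMulMatrix_apply, monomial_apply]
    by_cases H : h * g⁻¹ = σ <;> simp [D, H]
  have hsingle : ∀ h g (a : L), Matrix.single h g a ∈ R := by
    intro h g a
    refine hD (h * g⁻¹) ⟨Pi.single h⁻¹ (a * (h⁻¹ (ξ (h * g⁻¹, g) : L))⁻¹), ?_⟩
    ext i j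
    have h0 : h⁻¹ (ξ (h * g⁻¹, g) : L) ≠ 0 := by simp
    by_cases hi : i = h
    · subst hi
      by_cases hj : j = g
      · subst hj
        simp only [D, LinearMap.coe_mk, AddHom.coe_mk, Matrix.of_apply, if_true, Pi.single_eq_same,
          Matrix.single_apply_same]
        field_simp
      · simp [D, hj, Ne.symm hj]
    · simp [D, hi, Ne.symm hi, Pi.single_apply]
  intro N
  have : N ∈ R := by
    rw [Matrix.matrix_eq_sum_single N]
    exact sum_mem fun _ _ => sum_mem fun _ _ => hsingle _ _ _
  exact this

open Classical in
theorem splittingHom_bijective [IsGalois k L] (hξ : IsTwoCocycle k L ξ) :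
    Function.Bijective (splittingHom hξ) := by
  have hs := splittingHom_surjective hξ
  refine ⟨?_, hs⟩
  refine (LinearMap.injective_iff_surjective_of_finrank_eq_finrank
    (f := (splittingHom hξ).toLinearMap) ?_).mpr hs
  rw [Module.finrank_baseChange, finrank_eq, Module.finrank_matrix, ← Nat.card_eq_fintype_card,
    IsGalois.card_aut_eq_finrank, Module.finrank_self]
  ring

end Splitting

/-! ### Reduced trace -/

section ReducedTrace

variable {k L : Type u} [Field k] [Field L] [Algebra k L] [FiniteDimensional k L] [IsGalois k L]
  {ξ : Gal(L/k) × Gal(L/k) → Lˣ} {hξ : IsTwoCocycle k L ξ}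

/-- Under any splitting, the matrix trace is a functional to which `traceFunctional_eq` applies; its
value at `1` is `n`, a dimension count gives `n = [L : k]`, and `n` cancels in characteristic zero.
-/
theorem eq_trace_of_isReducedTrace [CharZero k] {x : CrossedProduct k L ξ hξ} {t : k}
    (h : IsReducedTrace k (CrossedProduct k L ξ hξ) x t) :
    t = Algebra.trace k L (x.coeff 1 * ξ (1, 1)) := by
  obtain ⟨K, _, _, n, e, he⟩ := h
  have hn : n = Module.finrank k L := by
    have h1 := e.toLinearEquiv.finrank_eq
    rw [Module.finrank_baseChange, finrank_eq, Module.finrank_matrix, Module.finrank_self,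
      Fintype.card_fin, mul_one, ← sq] at h1
    exact (Nat.pow_left_injective two_ne_zero h1).symm
  let f : CrossedProduct k L ξ hξ →ₗ[k] K :=
    ((Matrix.traceLinearMap (Fin n) K K).restrictScalars k) ∘ₗ
      (e.toLinearEquiv.toLinearMap.restrictScalars k) ∘ₗ
        (TensorProduct.mk k K (CrossedProduct k L ξ hξ) 1)
  have hf' : ∀ x, f x = (e ((1 : K) ⊗ₜ[k] x)).trace := fun _ => rfl
  have hf : ∀ x y, f (x * y) = f (y * x) := by
    intro x y
    have hm : ∀ x y : CrossedProduct k L ξ hξ,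
        (1 : K) ⊗ₜ[k] (x * y) = (1 ⊗ₜ[k] x) * (1 ⊗ₜ[k] y) := fun x y => by simp
    rw [hf', hf', hm, hm, map_mul, map_mul, Matrix.trace_mul_comm]
  have h1 : f 1 = (n : K) := by
    rw [hf', ← Algebra.TensorProduct.one_def, map_one, Matrix.trace_one, Fintype.card_fin]
  have hx := traceFunctional_eq f hf x
  have hnk : (n : k) ≠ 0 := by
    rw [hn]; exact_mod_cast (Module.finrank_pos (R := k) (M := L)).ne'
  rw [hf', ← he, h1, ← hn, Algebra.smul_def, Algebra.smul_def, map_natCast, mul_comm] at hx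
  have hnK : (n : K) ≠ 0 := by
    rw [← map_natCast (algebraMap k K)]
    exact (map_ne_zero _).mpr hnk
  exact (algebraMap k K).injective (mul_right_cancel₀ hnK hx)

theorem exists_isReducedTrace [CharZero k] (x : CrossedProduct k L ξ hξ) :
    ∃ t, IsReducedTrace k (CrossedProduct k L ξ hξ) x t := by
  classical
  refine ⟨Algebra.trace k L (x.coeff 1 * ξ (1, 1)), L, inferInstance, inferInstance,
    Fintype.card Gal(L/k), (AlgEquiv.ofBijective _ (splittingHom_bijective hξ)).trans
      (Matrix.reindexAlgEquiv L L (Fintype.equivFin _)), ?_⟩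
  have htr : ∀ (N : Matrix Gal(L/k) Gal(L/k) L), (Matrix.reindexAlgEquiv L L
      (Fintype.equivFin Gal(L/k)) N).trace = N.trace := fun N => by
    exact Equiv.sum_comp (Fintype.equivFin Gal(L/k)).symm N.diag
  -- The diagonal entry at `g` is the conjugate under `g⁻¹`, hence the reindexing by inversion.
  rw [AlgEquiv.trans_apply, htr, trace_eq_sum_automorphisms,
    ← Equiv.sum_comp (Equiv.inv Gal(L/k))]
  refine Finset.sum_congr rfl fun g _ => ?_
  rw [AlgEquiv.coe_ofBijective, splittingHom_one_tmul, Matrix.diag_apply, leftMulMatrix_apply,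
    mul_inv_cancel, cocycle_one_left hξ g]
  rfl

theorem reducedTrace_eq [CharZero k] (x : CrossedProduct k L ξ hξ) :
    reducedTrace k (CrossedProduct k L ξ hξ) x =
      Algebra.trace k L (x.coeff 1 * ξ (1, 1)) := by
  have h := exists_isReducedTrace x
  rw [reducedTrace, dif_pos h]
  exact eq_trace_of_isReducedTrace h.choose_spec

end ReducedTrace

end CrossedProd.CrossedProduct
namespace CrossedProd.CrossedProduct

/-! ### The candidate involution -/

section Conjugation

variable {k : Type u} {L : Type v} [Field k] [Field L] [Algebra k L]
  {ξ : Gal(L/k) × Gal(L/k) → Lˣ} {hξ : IsTwoCocycle k L ξ}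

/-- The map `∑ x_σ e_σ ↦ ∑ e_σ⁻¹ α(x_σ)`. -/
noncomputable def conjugation (hξ : IsTwoCocycle k L ξ) (α : L ≃+* L)
    (x : CrossedProduct k L ξ hξ) : CrossedProduct k L ξ hξ :=
  ⟨fun g => (invCoeff ξ g)⁻¹ * g (α (x.coeff g⁻¹))⟩

theorem conjugation_apply (α : L ≃+* L) (x : CrossedProduct k L ξ hξ) (g : Gal(L/k)) :
    (conjugation hξ α x).coeff g = (invCoeff ξ g)⁻¹ * g (α (x.coeff g⁻¹)) := rfl

theorem conjugation_add (α : L ≃+* L) (x y : CrossedProduct k L ξ hξ) :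
    conjugation hξ α (x + y) = conjugation hξ α x + conjugation hξ α y := by
  ext g
  simp only [conjugation_apply, add_apply, map_add, mul_add]

variable {α : L ≃+* L} (hunit : ∀ σ ρ : Gal(L/k), α (ξ (σ, ρ) : L) * (ξ (σ, ρ) : L) = 1)

include hunit in
theorem apply_cocycle_eq_inv (σ ρ : Gal(L/k)) : α (ξ (σ, ρ) : L) = (ξ (σ, ρ) : L)⁻¹ :=
  eq_inv_of_mul_eq_one_left (hunit σ ρ)

include hunit in
theorem conjugation_involutive (hcomm : ∀ (σ : Gal(L/k)) (z : L), α (σ z) = σ (α z))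
    (hα : ∀ z, α (α z) = z) (x : CrossedProduct k L ξ hξ) :
    conjugation hξ α (conjugation hξ α x) = x := by
  ext g
  have h1 : α (invCoeff ξ g⁻¹) = (invCoeff ξ g⁻¹)⁻¹ := by
    rw [invCoeff, map_mul, apply_cocycle_eq_inv hunit, apply_cocycle_eq_inv hunit, mul_inv]
  have h2 : g (g⁻¹ (x.coeff g)) = x.coeff g := AlgEquiv.apply_symm_apply g _
  have h3 := invCoeff_ne_zero (ξ := ξ) g
  rw [conjugation_apply, conjugation_apply, inv_inv, map_mul, map_inv₀, h1, hcomm, hα, inv_inv,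
    map_mul, apply_invCoeff_inv hξ, h2]
  field_simp

variable [FiniteDimensional k L]

include hunit in
-- Inversion reverses `e_σ e_ρ = ξ(σ, ρ) e_{σρ}`, and this is compatible with `α` because `α(ξ) =
-- ξ⁻¹`; the relation `e_σ λ = σ(λ) e_σ` is respected because `α` commutes with `σ`.
theorem conjugation_mul (hcomm : ∀ (σ : Gal(L/k)) (z : L), α (σ z) = σ (α z))
    (x y : CrossedProduct k L ξ hξ) :
    conjugation hξ α (x * y) = conjugation hξ α y * conjugation hξ α x := by
  ext g
  simp only [conjugation_apply, mul_apply, map_sum, Finset.mul_sum]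
  refine Fintype.sum_equiv (Equiv.mulLeft g) _ _ fun h => ?_
  have e1 : (g * h)⁻¹ * g = h⁻¹ := by group
  have e2 : (g * h)⁻¹ = h⁻¹ * g⁻¹ := by group
  have e3 : ∀ t, (g * h) (h⁻¹ t) = g t := fun t => by
    rw [← AlgEquiv.mul_apply, mul_inv_cancel_right]
  simp only [Equiv.coe_mulLeft, e1, inv_inv, map_mul, map_inv₀, hcomm, e3,
    apply_cocycle_eq_inv hunit, AlgEquiv.mul_apply]
  rw [e2]
  have c1 := cocycle_coe hξ g h (h⁻¹ * g⁻¹)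
  have c2 := cocycle_coe hξ (g * h) h⁻¹ h
  rw [mul_inv_cancel_left] at c1
  rw [mul_inv_cancel_right, inv_mul_cancel, cocycle_one_right hξ (g * h)] at c2
  simp only [invCoeff, map_mul, inv_inv, AlgEquiv.mul_apply, e2] at c1 c2 ⊢
  -- The coefficient form of `(e_g e_h)⁻¹ = e_h⁻¹ e_g⁻¹` up to cocycle factors, obtained by
  -- eliminating `ξ (g, h)`-type terms between two cocycle identities.
  have key : (ξ (g * h, h⁻¹ * g⁻¹) : L) * ξ (1, 1) *
      (g (h (ξ (h⁻¹, h) : L)) * g (h (ξ (1, 1) : L))) =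
      ξ (g, g⁻¹) * ξ (1, 1) * g (ξ (h, h⁻¹ * g⁻¹) : L) * ξ (g * h, h⁻¹) := by
    linear_combination (ξ (1, 1) : L) * ξ (g * h, h⁻¹) * c1 -
      (ξ (g * h, h⁻¹ * g⁻¹) : L) * ξ (1, 1) * c2
  have n := (ξ (g * h, h⁻¹)).ne_zero
  rw [mul_assoc (((ξ (g * h, h⁻¹ * g⁻¹) : L) * ξ (1, 1))⁻¹), mul_left_comm (g (h _)),
    ← mul_assoc (((ξ (g * h, h⁻¹ * g⁻¹) : L) * ξ (1, 1))⁻¹), ← mul_inv, key]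
  field_simp

theorem conjugation_ofField (hunit : ∀ σ ρ : Gal(L/k), α (ξ (σ, ρ) : L) * (ξ (σ, ρ) : L) = 1)
    (z : L) :
    conjugation hξ α (ofField z) = ofField (α z) := by
  ext g
  rw [conjugation_apply, ofField_eq_monomial, ofField_eq_monomial, monomial_apply, monomial_apply]
  have n1 := (ξ (1, 1)).ne_zero
  by_cases h : g = 1
  · subst h
    simp only [inv_one, if_true, map_mul, map_inv₀, apply_cocycle_eq_inv hunit, AlgEquiv.one_apply,
      invCoeff]
    field_simp
  · simp [h]

theorem conjugation_mul_self_coeff_one (x : CrossedProduct k L ξ hξ) :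
    (conjugation hξ α x * x).coeff 1 * ξ (1, 1) =
      ∑ σ : Gal(L/k), σ (α (x.coeff σ⁻¹) * x.coeff σ⁻¹) := by
  rw [mul_apply, Finset.sum_mul]
  refine Finset.sum_congr rfl fun σ _ => ?_
  have n1 := (ξ (1, 1)).ne_zero
  have n2 := (ξ (σ, σ⁻¹)).ne_zero
  rw [conjugation_apply, invCoeff, mul_one, map_mul]
  field_simp

instance : Nontrivial (CrossedProduct k L ξ hξ) :=
  ⟨0, 1, fun h => by
    have := congrArg (fun x => x.coeff 1) h
    exact (ξ (1, 1)).ne_zero (by simpa [zero_apply, one_apply, eq_comm] using this)⟩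

end Conjugation

end CrossedProd.CrossedProduct

/-! ### Density of conjugate vectors and the indefinite form -/

section Density

/-- A subfield of `ℂ` that is not contained in the reals is dense. -/
theorem denseRange_algebraMap_complex {K : Type*} [Field K] [Algebra K ℂ]
    (z : K) (hz : (algebraMap K ℂ z).im ≠ 0) : DenseRange (algebraMap K ℂ) := by
  have h := Complex.subfield_eq_of_closed
    (Subfield.isClosed_topologicalClosure (algebraMap K ℂ).fieldRange)
  have hmem : algebraMap K ℂ z ∈ (algebraMap K ℂ).fieldRange.topologicalClosure :=
    Subfield.le_topologicalClosure _ ⟨z, rfl⟩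
  rcases h with h | h
  · rw [h] at hmem
    obtain ⟨r, hr⟩ := hmem
    exact absurd (by rw [← hr]; simp) hz
  · intro w
    have : w ∈ (algebraMap K ℂ).fieldRange.topologicalClosure := h ▸ Subfield.mem_top w
    change w ∈ closure ((algebraMap K ℂ).fieldRange : Set ℂ) at this
    rwa [RingHom.coe_fieldRange] at this

theorem denseRange_galois_conjugates {k L : Type*} [Field k] [Field L] [Algebra k L]
    [Algebra k ℂ] [Algebra L ℂ] [IsScalarTower k L ℂ] [FiniteDimensional k L]
    (hk : DenseRange (algebraMap k ℂ)) :
    DenseRange fun (z : L) (σ : Gal(L/k)) => algebraMap L ℂ (σ z) := by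
  let φ : L →ₗ[k] (Gal(L/k) → ℂ) :=
    LinearMap.pi fun σ => (IsScalarTower.toAlgHom k L ℂ).toLinearMap ∘ₗ σ.toLinearMap
  -- The closure of a `k`-subspace is stable under complex scalars because `k` is dense in `ℂ`.
  let V : Submodule ℂ (Gal(L/k) → ℂ) :=
    { carrier := closure (Set.range φ)
      add_mem' := fun {v w} hv hw => map_mem_closure₂ continuous_add hv hw (by
        rintro _ ⟨a, rfl⟩ _ ⟨b, rfl⟩
        exact ⟨a + b, map_add _ _ _⟩)
      zero_mem' := subset_closure ⟨0, map_zero _⟩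
      smul_mem' := fun c v hv => map_mem_closure₂ continuous_smul (hk c) hv (by
        rintro _ ⟨a, rfl⟩ _ ⟨b, rfl⟩
        exact ⟨a • b, by rw [map_smul, algebraMap_smul]⟩) }
  have hV : V = ⊤ := by
    rw [eq_top_iff, ← span_range_galois_eq_top k L ℂ, Submodule.span_le]
    exact subset_closure
  intro v
  have : v ∈ V := hV ▸ Submodule.mem_top
  exact this

/-- If the trace form of an involution `α` of `L` is positive, then `α` commutes with
`Gal(L/k)`. -/
theorem commute_of_trace_pos {k L : Type*} [Field k] [Field L] [Algebra k L]
    [Algebra k ℂ] [Algebra L ℂ] [IsScalarTower k L ℂ] [FiniteDimensional k L] [IsGalois k L]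
    (hk : DenseRange (algebraMap k ℂ)) (α : L ≃+* L)
    (hα : ∀ z, algebraMap L ℂ (α z) = starRingEnd ℂ (algebraMap L ℂ z))
    (ι : k → k) (hαι : ∀ c, α (algebraMap k L c) = algebraMap k L (ι c))
    (hpos : ∀ z : L, z ≠ 0 → 0 < (algebraMap k ℂ (Algebra.trace k L (α z * z))).re)
    (σ : Gal(L/k)) (z : L) : α (σ z) = σ (α z) := by
  classical
  have hαα : ∀ z, α (α z) = z := fun z => (algebraMap L ℂ).injective (by simp [hα])
  -- Conjugation of `g` by `α`; it is `k`-linear since `α` preserves `k` and has order at most two.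
  let s : Gal(L/k) → Gal(L/k) := fun g =>
    AlgEquiv.ofRingEquiv (f := (α.trans (g : L ≃+* L)).trans α) (fun c => by
      have h := hαα (algebraMap k L c)
      rw [hαι, hαι] at h
      simp [hαι, h])
  have hs : ∀ g z, s g z = α (g (α z)) := fun _ _ => rfl
  have hss : ∀ g, s (s g) = g := fun g => by ext z; simp [hs, hαα]
  by_cases hσ : s σ = σ
  · have := hs σ (α z)
    rw [hσ, hαα] at this
    exact this.symm
  exfalso
  let F : (Gal(L/k) → ℂ) → ℝ := fun v => (∑ g, starRingEnd ℂ (v (s g)) * v g).re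
  have hF : Continuous F := by
    refine Complex.continuous_re.comp (continuous_finsetSum _ fun g _ => ?_)
    exact (Complex.continuous_conj.comp (continuous_apply _)).mul (continuous_apply _)
  have hFz : ∀ z : L, F (fun g => algebraMap L ℂ (g z)) =
      (algebraMap k ℂ (Algebra.trace k L (α z * z))).re := by
    intro z
    rw [IsScalarTower.algebraMap_apply k L ℂ, trace_eq_sum_automorphisms, map_sum]
    refine congrArg Complex.re (Finset.sum_congr rfl fun g _ => ?_)
    rw [← hα, hs, hαα, map_mul, map_mul]
  -- `F` pairs the coordinates `σ` and `s σ`, so opposite signs there give the value `-2`.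
  let v : Gal(L/k) → ℂ := fun g => if g = σ then 1 else if g = s σ then -1 else 0
  have hv : F v < 0 := by
    have h : ∀ g, starRingEnd ℂ (v (s g)) * v g = if g = σ ∨ g = s σ then -1 else 0 := by
      intro g
      by_cases h1 : g = σ
      · subst h1; simp [v, hσ]
      · by_cases h2 : g = s σ
        · subst h2; simp [v, hσ, hss]
        · simp [v, h1, h2]
    simp only [F, h, Complex.re_sum]
    refine Finset.sum_neg' (fun g _ => ?_) ⟨σ, Finset.mem_univ _, by simp⟩
    split_ifs <;> simp
  obtain ⟨z, hz⟩ := (denseRange_galois_conjugates (L := L) hk).exists_mem_open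
    (isOpen_lt hF continuous_const) ⟨v, hv⟩
  have hz' : F (fun g => algebraMap L ℂ (g z)) < 0 := hz
  by_cases hz0 : z = 0
  · subst hz0; simp [F] at hz'
  · rw [hFz] at hz'
    exact absurd (hpos z hz0) (not_lt.mpr hz'.le)

end Density
-- The equivalence
theorem corollary3p2
    -- `k/k₀` is a quadratic extension of number fields in `ℂ`, whose nontrivial automorphism `ι`
    -- is complex conjugation
    (k₀ : Subfield ℂ) [NumberField k₀]
    (k : IntermediateField k₀ ℂ) (hquad : Module.finrank k₀ k = 2)
    (ι : k ≃ₐ[k₀] k) (hι : ι ≠ 1) (hιconj : ∀ z : k, (ι z : ℂ) = starRingEnd ℂ (z : ℂ))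
    -- `L/k` is a finite Galois extension in `ℂ`, and complex conjugation induces `α` on `L`
    (L : IntermediateField k ℂ) [FiniteDimensional k L] [IsGalois k L]
    (α : L ≃+* L) (hα : ∀ z : L, (α z : ℂ) = starRingEnd ℂ (z : ℂ))
    -- `ξ` is a `2`-cocycle of unitary elements
    (ξ : Gal(L/k) × Gal(L/k) → (↥L)ˣ) (hξ : CrossedProd.IsTwoCocycle k L ξ)
    (hunit : ∀ σ ρ : Gal(L/k), α (ξ (σ, ρ) : L) * (ξ (σ, ρ) : L) = 1)
    -- `B = (ξ, L/k, G)` is a division algebra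
    (hdiv : ∀ x : CrossedProd.CrossedProduct k L ξ hξ, x ≠ 0 → IsUnit x) :
    (∃ τ : CrossedProd.CrossedProduct k L ξ hξ → CrossedProd.CrossedProduct k L ξ hξ,
        CrossedProd.IsUnitaryInvolution k₀ k τ ∧
        CrossedProd.IsPositiveInvolution k τ ∧
        ∀ z : L, τ (CrossedProd.CrossedProduct.ofField z) =
          CrossedProd.CrossedProduct.ofField (α z)) ↔
      ∀ σ : Gal(L/k), ∀ z : L, α (σ z) = σ (α z) := by

  have hιfix : ∀ c : k, ι c = c ↔ c ∈ Set.range (algebraMap k₀ k) := by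
    intro c
    refine ⟨fun hc => ?_, ?_⟩
    · by_contra hn
      -- A fixed `c` outside `k₀` would generate `k`, degree two leaving no intermediate field, and
      -- force `ι = 1`.
      have := IntermediateField.isSimpleOrder_of_finrank_prime k₀ k (hquad ▸ Nat.prime_two)
      have htop : IntermediateField.adjoin k₀ {c} = ⊤ :=
        (IsSimpleOrder.eq_bot_or_eq_top _).resolve_left fun h => hn
          (IntermediateField.mem_bot.mp (IntermediateField.adjoin_simple_eq_bot_iff.mp h))
      refine hι (AlgEquiv.ext fun z => ?_)
      have hz : z ∈ IntermediateField.adjoin k₀ {c} := htop ▸ IntermediateField.mem_top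
      change ι z = z
      induction hz using IntermediateField.adjoin_induction with
      | mem x hx => rwa [Set.mem_singleton_iff.mp hx]
      | algebraMap x => exact ι.commutes x
      | add x y _ _ hx hy => rw [map_add, hx, hy]
      | inv x _ hx => rw [map_inv₀, hx]
      | mul x y _ _ hx hy => rw [map_mul, hx, hy]
    · rintro ⟨a, rfl⟩
      exact ι.commutes a
  have hαk : ∀ c : k, α (algebraMap k L c) = algebraMap k L (ι c) := fun c =>
    Subtype.ext ((hα _).trans (hιconj c).symm)
  have hαα : ∀ z, α (α z) = z := fun z => Subtype.ext (by rw [hα, hα, Complex.conj_conj])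
  constructor
  · rintro ⟨τ, -, hpos, hτ⟩ σ z
    obtain ⟨c, hc⟩ : ∃ c : k, ι c ≠ c := by
      by_contra! h
      exact hι (AlgEquiv.ext h)
    refine commute_of_trace_pos (k := k) (denseRange_algebraMap_complex c fun him => hc ?_) α hα ι
      hαk (fun y hy => ?_) σ z
    · exact Subtype.ext ((hιconj c).trans (Complex.conj_eq_iff_im.mpr him))
    · have hne : CrossedProd.CrossedProduct.ofField (hξ := hξ) y ≠ 0 := fun h => hy (by
        have := congrArg (fun x => x.coeff 1) h
        simpa [CrossedProd.CrossedProduct.ofField_eq_monomial,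
          CrossedProd.CrossedProduct.monomial_apply,
          CrossedProd.CrossedProduct.zero_apply] using this)
      have h := (hpos _ hne).2
      rw [hτ, ← map_mul, CrossedProd.CrossedProduct.reducedTrace_eq,
        CrossedProd.CrossedProduct.ofField_eq_monomial,
        CrossedProd.CrossedProduct.monomial_apply, if_pos rfl,
        inv_mul_cancel_right₀ (ξ (1, 1)).ne_zero] at h
      exact h
  · intro hcomm
    refine ⟨CrossedProd.CrossedProduct.conjugation hξ α, ⟨
      CrossedProd.CrossedProduct.conjugation_add α,
      CrossedProd.CrossedProduct.conjugation_mul hunit hcomm,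
      CrossedProd.CrossedProduct.conjugation_involutive hunit hcomm hαα, fun c => ?_⟩,
      fun x hx => ?_, CrossedProd.CrossedProduct.conjugation_ofField hunit⟩
    · rw [← hιfix c, ← CrossedProd.CrossedProduct.ofField.commutes c,
        CrossedProd.CrossedProduct.conjugation_ofField hunit, hαk, AlgHom.commutes,
        AlgHom.commutes]
      exact (algebraMap k (CrossedProd.CrossedProduct k L ξ hξ)).injective.eq_iff
    · rw [CrossedProd.CrossedProduct.reducedTrace_eq,
        CrossedProd.CrossedProduct.conjugation_mul_self_coeff_one]
      -- Since `α` is complex conjugation and commutes with `G`, every conjugate of `α(y) y` is the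
      -- squared absolute value of a conjugate of `y`.
      have key : algebraMap k ℂ (Algebra.trace k L
          (∑ σ : Gal(L/k), σ (α (x.coeff σ⁻¹) * x.coeff σ⁻¹))) =
          ((∑ ρ : Gal(L/k), ∑ σ : Gal(L/k),
            Complex.normSq (algebraMap L ℂ (ρ (σ (x.coeff σ⁻¹)))) : ℝ) : ℂ) := by
        rw [IsScalarTower.algebraMap_apply k L ℂ, trace_eq_sum_automorphisms]
        push_cast
        simp only [map_sum, map_mul]
        refine Finset.sum_congr rfl fun ρ _ => Finset.sum_congr rfl fun σ _ => ?_
        rw [Complex.normSq_eq_conj_mul_self, ← hcomm, ← hcomm]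
        exact congrArg (· * _) (hα _)
      rw [key, Complex.ofReal_im, Complex.ofReal_re]
      refine ⟨rfl, Finset.sum_pos (fun ρ _ => ?_) Finset.univ_nonempty⟩
      refine Finset.sum_pos' (fun σ _ => Complex.normSq_nonneg _) ?_
      obtain ⟨g, hg⟩ : ∃ g, x.coeff g ≠ 0 := by
        by_contra! h
        exact hx (CrossedProd.CrossedProduct.ext h)
      exact ⟨g⁻¹, Finset.mem_univ _, Complex.normSq_pos.mpr (by simpa using hg)⟩
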